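/- For every integer $N\ge 1$ let $J(N)\ge 1$ be an integer, let $\{1,\dots,J(N)\}=\mathcal J^1_N\cup\mathcal J^2_N$ be a disjoint union (either set may be empty), and let $X_{1,N},\dots,X_{J(N),N}$ be independent random variables such that - for $j\in\mathcal J^1_N$, $X_{j,N}$ is geometric with parameter $\rho_{j,N}\in[0,1)$, i.e. $\mathbb P(X_{j,N}=k)=(1-\rho_{j,N})\rho_{j,N}^k$ for $k=0,1,2,\dots$ (with $0^0=1$); - for $j\in\mathcal J^2_N$, $X_{j,N}$ is Poisson with parameter $\lambda_{j,N}>0$, i.e. $\mathbb P(X_{j,N}=k)=e^{-\lambda_{j,N}}\lambda_{j,N}^k/k!$ for $k=0,1,2,\dots$. The probability space may depend on $N$. Put $S_N=\sum_{j=1}^{J(N)}X_{j,N}$, $a_N=\mathbb E(S_N)$ and $b_N=\big(\mathbb E[(S_N-a_N)^2]\big)^{1/2}$. Assume that (i) there is some $\rho<1$ such that $\rho_{j,N}\le\rho$ for all $N\ge1$ and all $j\in\mathcal J^1_N$; (ii) $\lim_{N\to\infty}b_N=+\infty$. Then $$\lim_{N\to\infty}\ \sup_{k\in\mathbb Z}\left|\,b_N\sqrt{2\pi}\;\mathbb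 P(S_N=k)-\exp\left(-\frac{(k-a_N)^2}{2b_N^2}\right)\right|=0 .$$ Here the supremum is finite for every $N\ge 1$ (if $b_N=0$, which by (ii) happens for only finitely many $N$, the quotient in the exponential is read as $0$). -/

import Mathlib

open MeasureTheory ProbabilityTheory Filter Topology
open scoped NNReal

/-- The geometric law on `{0, 1, 2, …} ⊆ ℝ` with parameter `ρ ∈ [0, 1)`, giving mass
`(1 - ρ) * ρ ^ k` to `k`. Mathlib's `geometricMeasure` is parametrized by the success
probability, which is `1 - ρ` here. -/
noncomputable def geometricLaw (ρ : unitInterval) : Measure ℝ :=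
  (geometricMeasure (unitInterval.symm ρ)).map (fun k : ℕ => (k : ℝ))

/-- The Poisson law on `{0, 1, 2, …} ⊆ ℝ` with parameter `l`, giving mass
`exp (-l) * l ^ k / k!` to `k`. -/
noncomputable def poissonLaw (l : ℝ≥0) : Measure ℝ :=
  (poissonMeasure l).map (fun k : ℕ => (k : ℝ))

theorem geometricLaw_real_singleton (ρ : unitInterval) (hρ : (ρ : ℝ) < 1) (k : ℕ) :
    (geometricLaw ρ).real {(k : ℝ)} = (1 - (ρ : ℝ)) * (ρ : ℝ) ^ k := by
  have hne : unitInterval.symm ρ ≠ 0 := by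
    intro h
    have h2 := congrArg (fun x : unitInterval => (x : ℝ)) h
    simp at h2
    linarith
  have hpre : (fun k : ℕ => (k : ℝ)) ⁻¹' {(k : ℝ)} = {k} := by ext; simp
  rw [geometricLaw, map_measureReal_apply (by fun_prop) (measurableSet_singleton _), hpre,
    geometricMeasure_real_singleton hne, unitInterval.coe_symm_eq]
  ring

theorem poissonLaw_real_singleton (l : ℝ≥0) (k : ℕ) :
    (poissonLaw l).real {(k : ℝ)} = Real.exp (-l) * (l : ℝ) ^ k / (Nat.factorial k : ℝ) := by
  have hpre : (fun k : ℕ => (k : ℝ)) ⁻¹' {(k : ℝ)} = {k} := by ext; simp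
  rw [poissonLaw, map_measureReal_apply (by fun_prop) (measurableSet_singleton _), hpre,
    poissonMeasure_real_singleton]

/-- The sum `S` of a finite family of real random variables. -/
noncomputable def rowSum {Ω : Type*} {n : ℕ} (X : Fin n → Ω → ℝ) (ω : Ω) : ℝ :=
  ∑ j, X j ω

/-- The mean `a = E(S)`. -/
noncomputable def rowMean {Ω : Type*} [MeasurableSpace Ω] (P : Measure Ω) {n : ℕ}
    (X : Fin n → Ω → ℝ) : ℝ :=
  ∫ ω, rowSum X ω ∂P

/-- The standard deviation `b = E((S - a)²)^(1/2)`. -/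
noncomputable def rowStd {Ω : Type*} [MeasurableSpace Ω] (P : Measure Ω) {n : ℕ}
    (X : Fin n → Ω → ℝ) : ℝ :=
  Real.sqrt (∫ ω, (rowSum X ω - rowMean P X) ^ 2 ∂P)

/-- The error `|b √(2π) P(S = k) - exp (-(k - a)² / (2 b²))|` in the local Gaussian
approximation of `S` at the integer `k`. -/
noncomputable def localError {Ω : Type*} [MeasurableSpace Ω] (P : Measure Ω) {n : ℕ}
    (X : Fin n → Ω → ℝ) (k : ℤ) : ℝ :=
  |rowStd P X * Real.sqrt (2 * Real.pi) * P.real {ω | rowSum X ω = (k : ℝ)}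
    - Real.exp (-(((k : ℝ) - rowMean P X) ^ 2 / (2 * rowStd P X ^ 2)))|

theorem norm_cexp_mul_I_sub_taylor_two_le (x : ℝ) :
    ‖Complex.exp (x * Complex.I) - 1 - x * Complex.I + (x : ℂ) ^ 2 / 2‖ ≤ 4 * |x| ^ 3 := by
  rcases le_total |x| 1 with h | h
  · have h1 : ‖(x * Complex.I : ℂ)‖ ≤ 1 := by simpa using h
    have h2 := Complex.exp_bound h1 (n := 3) (by norm_num)
    have h3 : Complex.exp (x * Complex.I) - 1 - x * Complex.I + (x : ℂ) ^ 2 / 2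
        = Complex.exp (x * Complex.I)
          - ∑ m ∈ Finset.range 3, (x * Complex.I) ^ m / (m.factorial : ℂ) := by
      simp [Finset.sum_range_succ, Nat.factorial, mul_pow]
      ring
    rw [h3]
    refine h2.trans ?_
    have h4 : ‖(x * Complex.I : ℂ)‖ = |x| := by simp
    rw [h4, mul_comm]
    gcongr
    norm_num [Nat.factorial]
  · have e1 : ‖Complex.exp (x * Complex.I)‖ = 1 := Complex.norm_exp_ofReal_mul_I x
    have e2 : ‖(x * Complex.I : ℂ)‖ = |x| := by simp
    have e3 : ‖((x : ℂ) ^ 2 / 2)‖ = |x| ^ 2 / 2 := by simp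
    calc _ ≤ ‖Complex.exp (x * Complex.I)‖ + ‖(1 : ℂ)‖ + ‖(x * Complex.I : ℂ)‖
          + ‖((x : ℂ) ^ 2 / 2)‖ :=
          (norm_add_le _ _).trans (by gcongr; exact (norm_sub_le _ _).trans (by
            gcongr; exact norm_sub_le _ _))
      _ = 1 + 1 + |x| + |x| ^ 2 / 2 := by rw [e1, e2, e3, norm_one]
      _ ≤ 4 * |x| ^ 3 := by
        have h5 : |x| ≤ |x| ^ 2 := by nlinarith
        have h6 : |x| ^ 2 ≤ |x| ^ 3 := by nlinarith
        linarith

theorem norm_cexp_sub_cexp_le {z w : ℂ} (hz : z.re ≤ 0) (hw : w.re ≤ 0) :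
    ‖Complex.exp z - Complex.exp w‖ ≤ ‖z - w‖ := by
  have h := Convex.norm_image_sub_le_of_norm_deriv_le (𝕜 := ℂ) (f := Complex.exp) (C := 1)
    (s := {z : ℂ | z.re ≤ 0}) (x := w) (y := z)
    (fun x _ => Complex.differentiableAt_exp)
    (fun x hx => by
      rw [Complex.deriv_exp, Complex.norm_exp]
      exact Real.exp_le_one_iff.2 hx)
    (convex_halfSpace_re_le 0) hw hz
  simpa using h

/-- Products of complex numbers in the closed unit disc are `1`-Lipschitz in each factor. -/
theorem norm_prod_sub_prod_le_sum {ι : Type*} (s : Finset ι) (f g : ι → ℂ)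
    (hf : ∀ i ∈ s, ‖f i‖ ≤ 1) (hg : ∀ i ∈ s, ‖g i‖ ≤ 1) :
    ‖∏ i ∈ s, f i - ∏ i ∈ s, g i‖ ≤ ∑ i ∈ s, ‖f i - g i‖ := by
  classical
  induction s using Finset.induction_on with
  | empty => simp
  | insert a s ha ih =>
    have ih' := ih (fun i hi => hf i (Finset.mem_insert_of_mem hi))
      (fun i hi => hg i (Finset.mem_insert_of_mem hi))
    have hfs : ‖∏ i ∈ s, f i‖ ≤ 1 := by
      rw [norm_prod]
      exact Finset.prod_le_one (fun _ _ => norm_nonneg _)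
        (fun i hi => hf i (Finset.mem_insert_of_mem hi))
    have hga := hg a (Finset.mem_insert_self a s)
    rw [Finset.prod_insert ha, Finset.prod_insert ha, Finset.sum_insert ha]
    calc ‖f a * ∏ i ∈ s, f i - g a * ∏ i ∈ s, g i‖
        = ‖(f a - g a) * ∏ i ∈ s, f i + g a * (∏ i ∈ s, f i - ∏ i ∈ s, g i)‖ := by ring_nf
      _ ≤ ‖f a - g a‖ * ‖∏ i ∈ s, f i‖ + ‖g a‖ * ‖∏ i ∈ s, f i - ∏ i ∈ s, g i‖ := by
        rw [← norm_mul, ← norm_mul]; exact norm_add_le _ _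
      _ ≤ ‖f a - g a‖ * 1 + 1 * ∑ i ∈ s, ‖f i - g i‖ := by gcongr
      _ = _ := by ring

/-- A lattice law on `ℝ` whose characteristic function is dominated by a Gaussian on `[-π, π]`
and agrees with the Gaussian of the same mean and variance to third order, with errors controlled
linearly by the variance. -/
structure GaussianLike (ν : Measure ℝ) (c K : ℝ) : Prop where
  isProbabilityMeasure : IsProbabilityMeasure ν
  ae_int : ∀ᵐ (x : ℝ) ∂ν, ∃ n : ℤ, x = n
  memLp : MemLp id 2 ν
  norm_charFun_le : ∀ t, |t| ≤ Real.pi → ‖charFun ν t‖ ≤ Real.exp (-(c * Var[id; ν] * t ^ 2))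
  norm_sub_le : ∀ t, ‖charFun ν t * Complex.exp (-(t * (∫ x, x ∂ν) * Complex.I))
    - Complex.exp (-(Var[id; ν] * t ^ 2 / 2))‖ ≤ K * Var[id; ν] * |t| ^ 3

theorem measurableSet_int : MeasurableSet {x : ℝ | ∃ n : ℤ, x = n} := by
  have : {x : ℝ | ∃ n : ℤ, x = n} = Set.range (fun n : ℤ => (n : ℝ)) := by
    ext x; simp [eq_comm]
  rw [this]
  exact (Set.countable_range _).measurableSet

theorem ae_int_map_natCast (μ : Measure ℕ) :
    ∀ᵐ (x : ℝ) ∂(μ.map (fun k : ℕ => (k : ℝ))), ∃ n : ℤ, x = n := by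
  exact (ae_map_iff (by fun_prop) measurableSet_int).2
    (Eventually.of_forall fun k => ⟨k, by simp⟩)

theorem memLp_two_map_natCast {μ : Measure ℕ} (h2 : Integrable (fun n : ℕ => (n : ℝ) ^ 2) μ) :
    MemLp id 2 (μ.map (fun k : ℕ => (k : ℝ))) := by
  rw [memLp_map_measure_iff (by fun_prop) (by fun_prop)]
  exact (memLp_two_iff_integrable_sq .of_discrete).2 h2

theorem variance_map_natCast {μ : Measure ℕ} [IsProbabilityMeasure μ]
    (h2 : Integrable (fun n : ℕ => (n : ℝ) ^ 2) μ) :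
    Var[id; μ.map (fun k : ℕ => (k : ℝ))]
      = (∫ n : ℕ, (n : ℝ) ^ 2 ∂μ) - (∫ n : ℕ, (n : ℝ) ∂μ) ^ 2 := by
  rw [variance_map (by fun_prop) (by fun_prop), variance_eq_sub]
  · rfl
  · exact (memLp_two_iff_integrable_sq .of_discrete).2 h2

theorem hasSum_poisson_mul (l : ℝ≥0) :
    HasSum (fun n : ℕ => Real.exp (-l) * (l : ℝ) ^ n / (n.factorial : ℝ) * n) l := by
  rw [← hasSum_nat_add_iff' 1]
  have h := (hasSum_one_poissonMeasure l).mul_left (l : ℝ)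
  simp only [Finset.range_one, Finset.sum_singleton, Nat.cast_zero, mul_zero, sub_zero]
  rw [mul_one] at h
  convert! h using 2 with n
  rw [Nat.factorial_succ]
  push_cast
  field_simp
  ring

theorem hasSum_poisson_mul_sq (l : ℝ≥0) :
    HasSum (fun n : ℕ => Real.exp (-l) * (l : ℝ) ^ n / (n.factorial : ℝ) * (n : ℝ) ^ 2)
      (l ^ 2 + l) := by
  rw [← hasSum_nat_add_iff' 1]
  have h := ((hasSum_poisson_mul l).add (hasSum_one_poissonMeasure l)).mul_left (l : ℝ)
  simp only [Finset.range_one, Finset.sum_singleton, Nat.cast_zero, mul_zero, sub_zero,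
    ne_eq, OfNat.ofNat_ne_zero, not_false_eq_true, zero_pow]
  rw [show (l : ℝ) * (l + 1) = l ^ 2 + l by ring] at h
  convert! h using 2 with n
  rw [Nat.factorial_succ]
  push_cast
  field_simp
  ring

theorem gaussianLike_poissonLaw (l : ℝ≥0) {c K : ℝ} (hc : c ≤ 2 / Real.pi ^ 2) (hK : 4 ≤ K) :
    GaussianLike (poissonLaw l) c K := by
  have hi : Integrable (fun n : ℕ => (n : ℝ) ^ 2) (poissonMeasure l) := by
    rw [integrable_poissonMeasure_iff]
    simpa using (hasSum_poisson_mul_sq l).summable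
  have h1 : ∫ n : ℕ, (n : ℝ) ∂(poissonMeasure l) = l := by
    rw [integral_poissonMeasure]
    simpa using (hasSum_poisson_mul l).tsum_eq
  have h2 : ∫ n : ℕ, (n : ℝ) ^ 2 ∂(poissonMeasure l) = l ^ 2 + l := by
    rw [integral_poissonMeasure]
    simpa using (hasSum_poisson_mul_sq l).tsum_eq
  have hmean : ∫ x, x ∂(poissonLaw l) = l := by
    rw [poissonLaw, integral_map (by fun_prop) (by fun_prop), h1]
  have hvar : Var[id; poissonLaw l] = l := by
    rw [poissonLaw, variance_map_natCast hi, h1, h2]; ring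
  have hchar (t : ℝ) : charFun (poissonLaw l) t
      = Complex.exp (l * (Complex.exp (t * Complex.I) - 1)) := charFun_map_cast_poissonMeasure l t
  have hre (t : ℝ) : ((l : ℂ) * (Complex.exp (t * Complex.I) - 1)).re
      = l * (Real.cos t - 1) := by
    have : ((l : ℂ)) = ((l : ℝ) : ℂ) := rfl
    rw [this, Complex.re_ofReal_mul, Complex.sub_re, Complex.exp_ofReal_mul_I_re, Complex.one_re]
  refine ⟨Measure.isProbabilityMeasure_map (by fun_prop), ae_int_map_natCast _,
    memLp_two_map_natCast hi, fun t ht => ?_, fun t => ?_⟩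
  · rw [hchar, hvar, Complex.norm_exp, hre]
    refine Real.exp_le_exp.2 ?_
    have h3 := Real.cos_le_one_sub_mul_cos_sq ht
    have h4 : c * t ^ 2 ≤ 2 / Real.pi ^ 2 * t ^ 2 := by gcongr
    have h5 : (l : ℝ) * (Real.cos t - 1) ≤ l * (-(c * t ^ 2)) := by gcongr; linarith
    linarith
  · rw [hchar, hvar, hmean, ← Complex.exp_add]
    refine (norm_cexp_sub_cexp_le ?_ ?_).trans ?_
    · rw [Complex.add_re, hre]
      have : (-((t : ℂ) * ((l : ℝ) : ℂ) * Complex.I)).re = 0 := by simp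
      rw [this]
      nlinarith [Real.cos_le_one t, l.coe_nonneg]
    · have : (-((((l : ℝ) : ℂ)) * (t : ℂ) ^ 2 / 2)) = ((-(l * t ^ 2 / 2) : ℝ) : ℂ) := by
        push_cast; ring
      rw [this, Complex.ofReal_re]
      have := l.coe_nonneg
      have : 0 ≤ (l : ℝ) * t ^ 2 / 2 := by positivity
      linarith
    · have e : (l : ℂ) * (Complex.exp (t * Complex.I) - 1) + -((t : ℂ) * ((l : ℝ) : ℂ) * Complex.I)
          - -((((l : ℝ) : ℂ)) * (t : ℂ) ^ 2 / 2)
          = ((l : ℝ) : ℂ) * (Complex.exp (t * Complex.I) - 1 - t * Complex.I + (t : ℂ) ^ 2 / 2) := by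
        ring
      rw [e, norm_mul, Complex.norm_real, Real.norm_of_nonneg l.coe_nonneg]
      calc (l : ℝ) * _ ≤ l * (4 * |t| ^ 3) := by
            gcongr; exact norm_cexp_mul_I_sub_taylor_two_le t
        _ = 4 * l * |t| ^ 3 := by ring
        _ ≤ K * l * |t| ^ 3 := by gcongr

theorem hasSum_sq_mul_geometric {r : ℝ} (h0 : 0 ≤ r) (h1 : r < 1) :
    HasSum (fun n : ℕ => (n : ℝ) ^ 2 * r ^ n) (r * (1 + r) / (1 - r) ^ 3) := by
  have hr : ‖r‖ < 1 := by rwa [Real.norm_of_nonneg h0]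
  have hne : 1 - r ≠ 0 := by linarith
  have h := (((hasSum_choose_mul_geometric_of_norm_lt_one 2 hr).mul_left 2).sub
    ((hasSum_coe_mul_geometric_of_norm_lt_one hr).mul_left 3)).sub
    ((hasSum_geometric_of_lt_one h0 h1).mul_left 2)
  convert! h using 1
  · ext n
    rw [Nat.cast_choose_two]
    push_cast
    ring
  · field_simp
    ring

theorem charFun_geometricLaw {ρ : unitInterval} (hρ : (ρ : ℝ) < 1) (t : ℝ) :
    charFun (geometricLaw ρ) t = (1 - ρ) / (1 - ρ * Complex.exp (t * Complex.I)) := by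
  have hne : unitInterval.symm ρ ≠ 0 := by
    intro h; have := congrArg Subtype.val h; simp at this; linarith
  rw [geometricLaw, charFun_apply, integral_map (by fun_prop) (by fun_prop),
    integral_geometricMeasure hne]
  have hn : ‖(ρ : ℂ) * Complex.exp (t * Complex.I)‖ < 1 := by
    rw [norm_mul, Complex.norm_exp_ofReal_mul_I, mul_one, Complex.norm_real,
      Real.norm_of_nonneg ρ.2.1]
    exact hρ
  rw [div_eq_mul_inv, ← tsum_geometric_of_norm_lt_one hn, ← tsum_mul_left]
  refine tsum_congr fun n => ?_
  rw [mul_pow, ← Complex.exp_nat_mul, Real.inner_apply, Complex.real_smul,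
    unitInterval.coe_symm_eq]
  push_cast
  ring_nf

theorem norm_one_sub_mul_exp_sq (r t : ℝ) :
    ‖(1 : ℂ) - r * Complex.exp (t * Complex.I)‖ ^ 2 = (1 - r) ^ 2 + 2 * r * (1 - Real.cos t) := by
  rw [← Complex.normSq_eq_norm_sq, Complex.normSq_apply, Complex.sub_re, Complex.sub_im,
    Complex.re_ofReal_mul, Complex.im_ofReal_mul, Complex.exp_ofReal_mul_I_re,
    Complex.exp_ofReal_mul_I_im, Complex.one_re, Complex.one_im]
  linear_combination r ^ 2 * Real.sin_sq_add_cos_sq t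

theorem norm_geometric_charFun_le {r s c t : ℝ} (h0 : 0 ≤ r) (hrs : r ≤ s) (h1 : s < 1)
    (hc : c ≤ 2 / Real.pi ^ 2 / (1 + 4 / (1 - s) ^ 2)) (ht : |t| ≤ Real.pi) :
    ‖((1 - r) / (1 - r * Complex.exp (t * Complex.I)) : ℂ)‖
      ≤ Real.exp (-(c * (r / (1 - r) ^ 2) * t ^ 2)) := by
  have hr : 0 < 1 - r := by linarith
  have hs : 0 < 1 - s := by linarith
  set v := r / (1 - r) ^ 2 with hv
  have hv0 : 0 ≤ v := by positivity
  have hvs : v ≤ 1 / (1 - s) ^ 2 := by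
    rw [hv]; gcongr; linarith
  set y := 2 * v * (1 - Real.cos t) with hy
  have hcos := Real.cos_le_one_sub_mul_cos_sq ht
  have hy0 : 0 ≤ y := by
    have := Real.cos_le_one t
    have : 0 ≤ 1 - Real.cos t := by linarith
    positivity
  have hy4 : y ≤ 4 / (1 - s) ^ 2 := by
    have := Real.neg_one_le_cos t
    calc y ≤ 2 * v * 2 := by rw [hy]; gcongr; linarith
      _ = 4 * v := by ring
      _ ≤ 4 * (1 / (1 - s) ^ 2) := by gcongr
      _ = _ := by ring
  have hsq : ‖((1 - r) / (1 - r * Complex.exp (t * Complex.I)) : ℂ)‖ ^ 2 = 1 / (1 + y) := by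
    rw [norm_div, div_pow, norm_one_sub_mul_exp_sq]
    have : ‖(1 - r : ℂ)‖ = 1 - r := by
      rw [← Complex.ofReal_one, ← Complex.ofReal_sub, Complex.norm_real, Real.norm_of_nonneg hr.le]
    rw [this, hy, hv]
    have e : (1 - r) ^ 2 + 2 * r * (1 - Real.cos t)
        = (1 - r) ^ 2 * (1 + 2 * (r / (1 - r) ^ 2) * (1 - Real.cos t)) := by
      field_simp
    rw [e, div_mul_eq_div_div, div_self (by positivity)]
  refine le_of_sq_le_sq ?_ (Real.exp_pos _).le
  rw [hsq, ← Real.exp_nat_mul]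
  calc 1 / (1 + y) = -(y / (1 + y)) + 1 := by field_simp; ring
    _ ≤ Real.exp (-(y / (1 + y))) := Real.add_one_le_exp _
    _ ≤ _ := by
      refine Real.exp_le_exp.2 ?_
      have h3 : y / (1 + 4 / (1 - s) ^ 2) ≤ y / (1 + y) := by gcongr
      have h4 : 2 * v * (2 / Real.pi ^ 2 * t ^ 2) ≤ y := by
        rw [hy]; gcongr; linarith
      have h5 : 2 * v * (c * t ^ 2) ≤ y / (1 + 4 / (1 - s) ^ 2) := by
        calc 2 * v * (c * t ^ 2)
            ≤ 2 * v * (2 / Real.pi ^ 2 / (1 + 4 / (1 - s) ^ 2) * t ^ 2) := by gcongr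
          _ = 2 * v * (2 / Real.pi ^ 2 * t ^ 2) / (1 + 4 / (1 - s) ^ 2) := by ring
          _ ≤ _ := by gcongr
      push_cast
      nlinarith

theorem norm_geometric_charFun_sub_le {r s K t : ℝ} (h0 : 0 ≤ r) (hrs : r ≤ s) (h1 : s < 1)
    (hK : 8 / (1 - s) ≤ K)
    (hle : ‖((1 - r) / (1 - r * Complex.exp (t * Complex.I)) : ℂ)‖ ≤ 1) :
    ‖((1 - r) / (1 - r * Complex.exp (t * Complex.I)) : ℂ)
        * Complex.exp (-(t * (r / (1 - r) : ℝ) * Complex.I))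
      - Complex.exp (-((r / (1 - r) ^ 2 : ℝ) * t ^ 2 / 2))‖
      ≤ K * (r / (1 - r) ^ 2) * |t| ^ 3 := by
  have hr1 : r < 1 := by linarith
  have hr : 0 < 1 - r := by linarith
  have hs : 0 < 1 - s := by linarith
  have hnr : ‖r‖ < 1 := by rwa [Real.norm_of_nonneg h0]
  have hnr' : ‖(r : ℂ)‖ < 1 := by rwa [Complex.norm_real]
  have hnz : ‖(r : ℂ) * Complex.exp (t * Complex.I)‖ < 1 := by
    rwa [norm_mul, Complex.norm_exp_ofReal_mul_I, mul_one]
  have hne1 : (1 : ℂ) - r ≠ 0 := by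
    intro h; rw [sub_eq_zero] at h; rw [← h] at hnr'; simp at hnr'
  have hne2 : (1 : ℂ) - r * Complex.exp (t * Complex.I) ≠ 0 := by
    intro h; rw [sub_eq_zero] at h; rw [← h] at hnz; simp at hnz
  set L : ℂ := -Complex.log (1 - r * Complex.exp (t * Complex.I)) - -Complex.log (1 - r) with hL
  have hexpL : Complex.exp L = (1 - r) / (1 - r * Complex.exp (t * Complex.I)) := by
    rw [hL, sub_neg_eq_add, Complex.exp_add, Complex.exp_neg, Complex.exp_log hne1,
      Complex.exp_log hne2]
    field_simp
  set m : ℂ := ((r / (1 - r) : ℝ) : ℂ) with hm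
  set v : ℂ := ((r / (1 - r) ^ 2 : ℝ) : ℂ) with hv
  have hLre : L.re ≤ 0 := by
    rw [← hexpL, Complex.norm_exp] at hle
    exact Real.exp_le_one_iff.1 hle
  have hmsum : HasSum (fun n : ℕ => if n = 0 then (0 : ℂ) else (r : ℂ) ^ n) m := by
    rw [← hasSum_nat_add_iff' 1]
    have h := (hasSum_geometric_of_norm_lt_one hnr').mul_left (r : ℂ)
    convert! h using 1
    · ext n; simp [pow_succ']
    · rw [hm]; push_cast; simp [div_eq_mul_inv]
  have hvsum : HasSum (fun n : ℕ => (n : ℂ) * (r : ℂ) ^ n) v := by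
    have h := hasSum_coe_mul_geometric_of_norm_lt_one hnr'
    rw [hv]; push_cast; exact h
  have hsum : HasSum (fun n : ℕ => (r : ℂ) ^ n / n *
      (Complex.exp ((n * t : ℝ) * Complex.I) - 1 - (n * t : ℝ) * Complex.I
        + ((n * t : ℝ) : ℂ) ^ 2 / 2)) (L - t * m * Complex.I + v * t ^ 2 / 2) := by
    have h := (((Complex.hasSum_taylorSeries_neg_log hnz).sub
      (Complex.hasSum_taylorSeries_neg_log hnr')).sub (hmsum.mul_left (t * Complex.I))).add
      (hvsum.mul_left ((t : ℂ) ^ 2 / 2))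
    convert! h using 1
    · ext n
      rcases Nat.eq_zero_or_pos n with rfl | hn
      · simp
      · have hn' : (n : ℂ) ≠ 0 := by exact_mod_cast hn.ne'
        rw [if_neg hn.ne', mul_pow, ← Complex.exp_nat_mul]
        push_cast
        rw [← mul_assoc]
        field_simp
    · rw [hL]; ring
  have hbound (n : ℕ) : ‖(r : ℂ) ^ n / n *
      (Complex.exp ((n * t : ℝ) * Complex.I) - 1 - (n * t : ℝ) * Complex.I
        + ((n * t : ℝ) : ℂ) ^ 2 / 2)‖ ≤ 4 * |t| ^ 3 * ((n : ℝ) ^ 2 * r ^ n) := by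
    have h2 := norm_cexp_mul_I_sub_taylor_two_le (n * t)
    rw [norm_mul, norm_div, norm_pow, Complex.norm_real, Real.norm_of_nonneg h0,
      Complex.norm_natCast]
    refine (mul_le_mul_of_nonneg_left h2 (by positivity)).trans (le_of_eq ?_)
    rw [abs_mul, Nat.abs_cast]
    rcases Nat.eq_zero_or_pos n with rfl | hn
    · simp
    · have hn' : (n : ℝ) ≠ 0 := by exact_mod_cast hn.ne'
      field_simp
  have hnorm : ‖L - t * m * Complex.I + v * t ^ 2 / 2‖
      ≤ 4 * |t| ^ 3 * (r * (1 + r) / (1 - r) ^ 3) := by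
    rw [← hsum.tsum_eq]
    exact tsum_of_norm_bounded ((hasSum_sq_mul_geometric h0 hr1).mul_left _) hbound
  rw [← hexpL, ← Complex.exp_add]
  refine (norm_cexp_sub_cexp_le ?_ ?_).trans ?_
  · have : (-((t : ℂ) * m * Complex.I)).re = 0 := by
      have e : -((t : ℂ) * m * Complex.I) = ((-(t * (r / (1 - r))) : ℝ) : ℂ) * Complex.I := by
        rw [hm]; push_cast; ring
      rw [e, Complex.re_ofReal_mul, Complex.I_re, mul_zero]
    rw [Complex.add_re, this, add_zero]
    exact hLre
  · have : -(v * (t : ℂ) ^ 2 / 2) = ((-(r / (1 - r) ^ 2 * t ^ 2 / 2) : ℝ) : ℂ) := by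
      rw [hv]; push_cast; ring
    rw [this, Complex.ofReal_re]
    have : 0 ≤ r / (1 - r) ^ 2 * t ^ 2 / 2 := by positivity
    linarith
  · rw [show L + -(t * m * Complex.I) - -(v * t ^ 2 / 2)
      = L - t * m * Complex.I + v * t ^ 2 / 2 by ring]
    refine hnorm.trans ?_
    have h8 : 4 * (1 + r) / (1 - r) ≤ K := by
      refine le_trans ?_ hK
      gcongr
      linarith
    calc 4 * |t| ^ 3 * (r * (1 + r) / (1 - r) ^ 3)
        = 4 * (1 + r) / (1 - r) * (r / (1 - r) ^ 2) * |t| ^ 3 := by field_simp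
      _ ≤ _ := by gcongr

theorem gaussianLike_geometricLaw (ρ : unitInterval) {s c K : ℝ} (hρs : (ρ : ℝ) ≤ s) (hs : s < 1)
    (hc : c ≤ 2 / Real.pi ^ 2 / (1 + 4 / (1 - s) ^ 2)) (hK : 8 / (1 - s) ≤ K) :
    GaussianLike (geometricLaw ρ) c K := by
  have h0 : (0 : ℝ) ≤ ρ := ρ.2.1
  have hρ : (ρ : ℝ) < 1 := hρs.trans_lt hs
  have hne : unitInterval.symm ρ ≠ 0 := by
    intro h; have := congrArg Subtype.val h; simp at this; linarith
  have hr : (1 : ℝ) - ρ ≠ 0 := by linarith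
  have hnr : ‖(ρ : ℝ)‖ < 1 := by rwa [Real.norm_of_nonneg h0]
  have s1 : HasSum (fun n : ℕ => (1 - (unitInterval.symm ρ : ℝ)) ^ n * (unitInterval.symm ρ : ℝ)
      * (n : ℝ)) (ρ / (1 - ρ)) := by
    have h := (hasSum_coe_mul_geometric_of_norm_lt_one hnr).mul_left (1 - (ρ : ℝ))
    convert! h using 1
    · ext n; rw [unitInterval.coe_symm_eq]; ring
    · field_simp
  have s2 : HasSum (fun n : ℕ => (1 - (unitInterval.symm ρ : ℝ)) ^ n * (unitInterval.symm ρ : ℝ)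
      * (n : ℝ) ^ 2) ((ρ : ℝ) * (1 + ρ) / (1 - ρ) ^ 2) := by
    have h := (hasSum_sq_mul_geometric h0 hρ).mul_left (1 - (ρ : ℝ))
    convert! h using 1
    · ext n; rw [unitInterval.coe_symm_eq]; ring
    · field_simp
  have hi : Integrable (fun n : ℕ => (n : ℝ) ^ 2) (geometricMeasure (unitInterval.symm ρ)) := by
    rw [integrable_geometricMeasure_iff hne]
    simpa using s2.summable
  have h1 : ∫ n : ℕ, (n : ℝ) ∂(geometricMeasure (unitInterval.symm ρ)) = ρ / (1 - ρ) := by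
    rw [integral_geometricMeasure hne]
    exact s1.tsum_eq
  have h2 : ∫ n : ℕ, (n : ℝ) ^ 2 ∂(geometricMeasure (unitInterval.symm ρ))
      = (ρ : ℝ) * (1 + ρ) / (1 - ρ) ^ 2 := by
    rw [integral_geometricMeasure hne]
    exact s2.tsum_eq
  have hmean : ∫ x, x ∂(geometricLaw ρ) = ρ / (1 - ρ) := by
    rw [geometricLaw, integral_map (by fun_prop) (by fun_prop), h1]
  have hvar : Var[id; geometricLaw ρ] = ρ / (1 - ρ) ^ 2 := by
    rw [geometricLaw, variance_map_natCast hi, h1, h2]; field_simp; ring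
  have hprob : IsProbabilityMeasure (geometricLaw ρ) :=
    Measure.isProbabilityMeasure_map (by fun_prop)
  refine ⟨hprob, ae_int_map_natCast _, memLp_two_map_natCast hi, fun t ht => ?_, fun t => ?_⟩
  · rw [charFun_geometricLaw hρ, hvar]
    exact norm_geometric_charFun_le h0 hρs hs hc ht
  · have hle := norm_charFun_le_one (μ := geometricLaw ρ) (t := t)
    rw [charFun_geometricLaw hρ] at hle
    rw [charFun_geometricLaw hρ, hvar, hmean]
    exact norm_geometric_charFun_sub_le h0 hρs hs hK hle

theorem integral_cexp_int_mul (n : ℤ) :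
    ∫ t in -Real.pi..Real.pi, Complex.exp (n * t * Complex.I)
      = if n = 0 then 2 * (Real.pi : ℂ) else 0 := by
  split_ifs with h
  · subst h
    simp
    ring
  · have hc : (n : ℂ) * Complex.I ≠ 0 := by simp [h]
    have e (t : ℝ) : (n : ℂ) * t * Complex.I = n * Complex.I * t := by ring
    simp_rw [e]
    rw [integral_exp_mul_complex hc, div_eq_zero_iff]
    left
    rw [sub_eq_zero]
    push_cast
    rw [Complex.exp_eq_exp_iff_exists_int]
    exact ⟨n, by ring⟩

/-- Fourier inversion for a probability measure carried by the integers. -/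
theorem integral_charFun_mul_cexp {ν : Measure ℝ} [IsProbabilityMeasure ν]
    (hν : ∀ᵐ (x : ℝ) ∂ν, ∃ n : ℤ, x = n) (k : ℤ) :
    ∫ t in -Real.pi..Real.pi, charFun ν t * Complex.exp (-(t * k * Complex.I))
      = 2 * Real.pi * ν.real {(k : ℝ)} := by
  have e (t : ℝ) : charFun ν t * Complex.exp (-(t * k * Complex.I))
      = ∫ x, Complex.exp (t * (x - k) * Complex.I) ∂ν := by
    rw [charFun_apply_real, ← integral_mul_const]
    congr with x
    rw [← Complex.exp_add]
    ring_nf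
  simp_rw [e]
  rw [intervalIntegral_integral_swap]
  · have h1 : (fun x : ℝ => ∫ t in -Real.pi..Real.pi, Complex.exp (t * (x - k) * Complex.I))
        =ᵐ[ν] ({(k : ℝ)} : Set ℝ).indicator (fun _ => 2 * (Real.pi : ℂ)) := by
      filter_upwards [hν] with x ⟨n, hn⟩
      have h2 := integral_cexp_int_mul (n - k)
      have e2 : (fun t : ℝ => Complex.exp (t * (x - k) * Complex.I))
          = fun t : ℝ => Complex.exp (((n - k : ℤ) : ℂ) * t * Complex.I) := by
        ext t; rw [hn]; push_cast; ring_nf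
      rw [e2, h2, Set.indicator_apply, hn]
      simp [sub_eq_zero]
    rw [integral_congr_ae h1, integral_indicator (measurableSet_singleton _), setIntegral_const,
      Complex.real_smul]
    ring
  · have : IsFiniteMeasure (volume.restrict (Set.uIoc (-Real.pi) Real.pi)) :=
      ⟨by simp [Set.uIoc]⟩
    refine Integrable.of_bound (C := 1) (by
      apply Continuous.aestronglyMeasurable
      fun_prop) (Eventually.of_forall fun p => ?_)
    have : (p.1 : ℂ) * (p.2 - k) * Complex.I = ((p.1 * (p.2 - k) : ℝ) : ℂ) * Complex.I := by
      push_cast; ring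
    rw [Function.uncurry, this, Complex.norm_exp_ofReal_mul_I]

theorem integral_gaussian_mul_cexp (x : ℝ) :
    ∫ u : ℝ, Complex.exp (-(u ^ 2 / 2)) * Complex.exp (-(u * x * Complex.I))
      = Real.sqrt (2 * Real.pi) * Real.exp (-(x ^ 2 / 2)) := by
  have h := fourierIntegral_gaussian (b := 1 / 2) (by norm_num) (-x : ℂ)
  have e : (fun u : ℝ => Complex.exp (-(u ^ 2 / 2)) * Complex.exp (-(u * x * Complex.I)))
      = fun u : ℝ => Complex.exp (Complex.I * (-x) * u) * Complex.exp (-(1 / 2) * u ^ 2) := by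
    ext u
    rw [mul_comm]
    ring_nf
  rw [e, h]
  congr 1
  · rw [Real.sqrt_eq_rpow, Complex.ofReal_cpow (by positivity)]
    push_cast
    ring_nf
  · push_cast
    ring_nf

/-- A bound, depending only on the standard deviation `b`, for the distance between the
characteristic function at `u / b` of a standardized `GaussianLike` law, cut off at `π * b`, and
the standard Gaussian one. -/
noncomputable def charFunErrorBound (c K b u : ℝ) : ℝ :=
  min (Real.exp (-c * u ^ 2) + Real.exp (-(1 / 2) * u ^ 2)) ((K * |u| ^ 3 + |u|) / b)

theorem charFunErrorBound_nonneg {c K b : ℝ} (hK : 0 ≤ K) (hb : 0 ≤ b) (u : ℝ) :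
    0 ≤ charFunErrorBound c K b u :=
  le_min (by positivity) (by positivity)

theorem integrable_exp_add_exp {c : ℝ} (hc : 0 < c) :
    Integrable (fun u : ℝ => Real.exp (-c * u ^ 2) + Real.exp (-(1 / 2) * u ^ 2)) :=
  (integrable_exp_neg_mul_sq hc).add (integrable_exp_neg_mul_sq (by norm_num))

theorem continuous_charFunErrorBound (c K b : ℝ) : Continuous (charFunErrorBound c K b) := by
  unfold charFunErrorBound
  fun_prop

theorem integrable_charFunErrorBound {c K b : ℝ} (hc : 0 < c) (hK : 0 ≤ K) (hb : 0 ≤ b) :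
    Integrable (charFunErrorBound c K b) := by
  refine (integrable_exp_add_exp hc).mono'
    (continuous_charFunErrorBound c K b).aestronglyMeasurable
    (Eventually.of_forall fun u => ?_)
  rw [Real.norm_of_nonneg (charFunErrorBound_nonneg hK hb u)]
  exact min_le_left _ _

theorem tendsto_integral_charFunErrorBound {c K : ℝ} (hc : 0 < c) (hK : 0 ≤ K) :
    Tendsto (fun b => ∫ u, charFunErrorBound c K b u) atTop (𝓝 0) := by
  rw [← integral_zero ℝ ℝ]
  refine tendsto_integral_filter_of_dominated_convergence
    (fun u : ℝ => Real.exp (-c * u ^ 2) + Real.exp (-(1 / 2) * u ^ 2))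
    (Eventually.of_forall fun b => (continuous_charFunErrorBound c K b).aestronglyMeasurable)
    ?_ (integrable_exp_add_exp hc) (Eventually.of_forall fun u => ?_)
  · filter_upwards [eventually_ge_atTop 0] with b hb
    refine Eventually.of_forall fun u => ?_
    rw [Real.norm_of_nonneg (charFunErrorBound_nonneg hK hb u)]
    exact min_le_left _ _
  · refine tendsto_of_tendsto_of_tendsto_of_le_of_le' tendsto_const_nhds
      (tendsto_const_nhds.div_atTop tendsto_id : Tendsto (fun b => (K * |u| ^ 3 + |u|) / b) _ _)
      ?_ (Eventually.of_forall fun b => min_le_right _ _)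
    filter_upwards [eventually_ge_atTop 0] with b hb
    exact charFunErrorBound_nonneg hK hb u

namespace GaussianLike

variable {ν : Measure ℝ} {c K b : ℝ}

theorem norm_indicator_sub_le (h : GaussianLike ν c K) (hK : 0 ≤ K) (hb : 0 < b)
    (hv : Var[id; ν] = b ^ 2) (k : ℤ) (u : ℝ) :
    ‖(Set.Ioc (-Real.pi * b) (Real.pi * b)).indicator
        (fun u : ℝ => charFun ν (u / b) * Complex.exp (-((u / b : ℝ) * k * Complex.I))) u
      - Complex.exp (-(u ^ 2 / 2))
        * Complex.exp (-(u * (((k - ∫ x, x ∂ν) / b : ℝ) : ℂ) * Complex.I))‖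
      ≤ charFunErrorBound c K b u := by
  set m : ℝ := ∫ x, x ∂ν with hm
  have hphase : ‖Complex.exp (-(u * (((k - m) / b : ℝ) : ℂ) * Complex.I))‖ = 1 := by
    have : -((u : ℂ) * (((k - m) / b : ℝ) : ℂ) * Complex.I)
        = ((-(u * ((k - m) / b)) : ℝ) : ℂ) * Complex.I := by push_cast; ring
    rw [this, Complex.norm_exp_ofReal_mul_I]
  have hgauss : ‖Complex.exp (-((u : ℂ) ^ 2 / 2))‖ = Real.exp (-(1 / 2) * u ^ 2) := by
    have : -((u : ℂ) ^ 2 / 2) = ((-(1 / 2) * u ^ 2 : ℝ) : ℂ) := by push_cast; ring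
    rw [this, ← Complex.ofReal_exp, Complex.norm_real, Real.norm_of_nonneg (Real.exp_pos _).le]
  have hbC : (b : ℂ) ≠ 0 := by exact_mod_cast hb.ne'
  by_cases hu : u ∈ Set.Ioc (-Real.pi * b) (Real.pi * b)
  · rw [Set.indicator_of_mem hu]
    have habs : |u / b| ≤ Real.pi := by
      rw [abs_le, le_div_iff₀ hb, div_le_iff₀ hb]
      exact ⟨hu.1.le, hu.2⟩
    refine le_min ?_ ?_
    · refine (_root_.norm_sub_le _ _).trans ?_
      rw [norm_mul, norm_mul, hphase, hgauss, mul_one]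
      have h1 : ‖Complex.exp (-(((u / b : ℝ) : ℂ) * k * Complex.I))‖ = 1 := by
        have : -(((u / b : ℝ) : ℂ) * k * Complex.I)
            = ((-(u / b * k) : ℝ) : ℂ) * Complex.I := by push_cast; ring
        rw [this, Complex.norm_exp_ofReal_mul_I]
      rw [h1, mul_one]
      have h2 := h.norm_charFun_le (u / b) habs
      rw [hv] at h2
      have h3 : -(c * b ^ 2 * (u / b) ^ 2) = -c * u ^ 2 := by field_simp
      rw [h3] at h2
      gcongr
    · have h1 := h.norm_sub_le (u / b)
      rw [hv] at h1
      have e1 : charFun ν (u / b) * Complex.exp (-((u / b : ℝ) * k * Complex.I))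
          = charFun ν (u / b) * Complex.exp (-((u / b : ℝ) * (m : ℂ) * Complex.I))
            * Complex.exp (-(u * (((k - m) / b : ℝ) : ℂ) * Complex.I)) := by
        rw [mul_assoc (charFun ν _), ← Complex.exp_add]
        congr 2
        push_cast
        ring
      have e2 : Complex.exp (-((u : ℂ) ^ 2 / 2))
          = Complex.exp (-(((b ^ 2 : ℝ) : ℂ) * ((u / b : ℝ) : ℂ) ^ 2 / 2)) := by
        congr 1
        push_cast
        field_simp
      rw [e1, e2, ← sub_mul, norm_mul, hphase, mul_one]
      refine h1.trans ?_
      rw [abs_div, abs_of_pos hb]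
      have h4 : K * b ^ 2 * (|u| / b) ^ 3 = K * |u| ^ 3 / b := by field_simp
      rw [h4]
      gcongr
      exact le_add_of_nonneg_right (abs_nonneg u)
  · rw [Set.indicator_of_notMem hu, zero_sub, norm_neg, norm_mul, hphase, hgauss, mul_one]
    refine le_min (le_add_of_nonneg_left (Real.exp_pos _).le) ?_
    have hbu : b ≤ |u| := by
      by_contra hlt
      push Not at hlt
      have h1 := abs_lt.1 hlt
      have h2 : b ≤ Real.pi * b := by nlinarith [Real.pi_gt_three]
      exact hu ⟨by linarith, by linarith⟩
    rw [le_div_iff₀ hb]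
    have h3 : Real.exp (-(1 / 2) * u ^ 2) ≤ 1 := Real.exp_le_one_iff.2 (by nlinarith [sq_nonneg u])
    calc Real.exp (-(1 / 2) * u ^ 2) * b ≤ 1 * |u| := by gcongr
      _ ≤ K * |u| ^ 3 + |u| := by
        have : 0 ≤ K * |u| ^ 3 := by positivity
        linarith

/-- Local limit theorem for `GaussianLike` laws, with an error depending only on the standard
deviation. -/
theorem abs_sub_le (h : GaussianLike ν c K) (hc : 0 < c) (hK : 0 ≤ K) (hb : 0 < b)
    (hv : Var[id; ν] = b ^ 2) (k : ℤ) :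
    |b * Real.sqrt (2 * Real.pi) * ν.real {(k : ℝ)}
      - Real.exp (-((k - ∫ x, x ∂ν) ^ 2 / (2 * b ^ 2)))|
      ≤ (Real.sqrt (2 * Real.pi))⁻¹ * ∫ u, charFunErrorBound c K b u := by
  have := h.isProbabilityMeasure
  set m : ℝ := ∫ x, x ∂ν with hm
  set G : ℝ → ℂ := fun u => charFun ν (u / b) * Complex.exp (-((u / b : ℝ) * k * Complex.I))
    with hG
  set s := Set.Ioc (-Real.pi * b) (Real.pi * b) with hs
  set x : ℝ := (k - m) / b with hx
  have hsqrt : 0 < Real.sqrt (2 * Real.pi) := Real.sqrt_pos.2 (by positivity)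
  have hI1 : ∫ u, s.indicator G u = ((b * (2 * Real.pi * ν.real {(k : ℝ)}) : ℝ) : ℂ) := by
    have hle : -Real.pi * b ≤ Real.pi * b := by nlinarith [Real.pi_pos]
    rw [integral_indicator measurableSet_Ioc, ← intervalIntegral.integral_of_le hle]
    have h1 := intervalIntegral.integral_comp_div (a := -Real.pi * b) (b := Real.pi * b)
      (fun t : ℝ => charFun ν t * Complex.exp (-(t * k * Complex.I))) hb.ne'
    rw [mul_div_cancel_right₀ _ hb.ne', mul_div_cancel_right₀ _ hb.ne',
      integral_charFun_mul_cexp h.ae_int, Complex.real_smul] at h1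
    rw [hG, h1]
    push_cast
    ring
  have hGi : Integrable (s.indicator G) := by
    rw [integrable_indicator_iff measurableSet_Ioc]
    refine Measure.integrableOn_of_bounded (M := 1) (by simp) ?_
      (Eventually.of_forall fun u => ?_)
    · refine Measurable.aestronglyMeasurable ?_
      have := measurable_charFun (μ := ν)
      fun_prop
    · have h1 : -(((u / b : ℝ) : ℂ) * k * Complex.I)
          = ((-(u / b * k) : ℝ) : ℂ) * Complex.I := by push_cast; ring
      rw [hG]
      beta_reduce
      rw [norm_mul, h1, Complex.norm_exp_ofReal_mul_I, mul_one]
      exact norm_charFun_le_one _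
  have hGauss := integral_gaussian_mul_cexp x
  have hgi : Integrable (fun u : ℝ =>
      Complex.exp (-(u ^ 2 / 2)) * Complex.exp (-(u * x * Complex.I))) := by
    by_contra hni
    rw [integral_undef hni] at hGauss
    exact (mul_ne_zero (Complex.ofReal_ne_zero.2 hsqrt.ne')
      (Complex.ofReal_ne_zero.2 (Real.exp_pos _).ne')) hGauss.symm
  have hbd : ‖(∫ u, s.indicator G u) - ∫ u : ℝ,
      Complex.exp (-(u ^ 2 / 2)) * Complex.exp (-(u * x * Complex.I))‖
      ≤ ∫ u, charFunErrorBound c K b u := by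
    rw [← integral_sub hGi hgi]
    exact norm_integral_le_of_norm_le (integrable_charFunErrorBound hc hK hb.le)
      (Eventually.of_forall fun u => h.norm_indicator_sub_le hK hb hv k u)
  rw [hI1, hGauss, ← Complex.ofReal_mul, ← Complex.ofReal_sub, Complex.norm_real,
    Real.norm_eq_abs] at hbd
  have hxx : x ^ 2 / 2 = (k - m) ^ 2 / (2 * b ^ 2) := by
    rw [hx]; field_simp
  rw [hxx] at hbd
  have hss : Real.sqrt (2 * Real.pi) * Real.sqrt (2 * Real.pi) = 2 * Real.pi :=
    Real.mul_self_sqrt (by positivity)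
  have hfactor : b * (2 * Real.pi * ν.real {(k : ℝ)})
        - Real.sqrt (2 * Real.pi) * Real.exp (-((k - m) ^ 2 / (2 * b ^ 2)))
      = (b * Real.sqrt (2 * Real.pi) * ν.real {(k : ℝ)}
        - Real.exp (-((k - m) ^ 2 / (2 * b ^ 2)))) * Real.sqrt (2 * Real.pi) := by
    linear_combination (-(b * ν.real {(k : ℝ)})) * hss
  rw [inv_mul_eq_div, le_div_iff₀ hsqrt]
  rwa [hfactor, abs_mul, abs_of_pos hsqrt] at hbd

end GaussianLike

theorem GaussianLike.rowSum {Ω : Type*} [MeasurableSpace Ω] {P : Measure Ω}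
    [IsProbabilityMeasure P] {n : ℕ} {X : Fin n → Ω → ℝ} {c K : ℝ}
    (hX : ∀ j, AEMeasurable (X j) P) (hindep : iIndepFun X P)
    (h : ∀ j, GaussianLike (P.map (X j)) c K) :
    GaussianLike (P.map (rowSum X)) c K := by
  have hS : AEMeasurable (_root_.rowSum X) P := by
    unfold _root_.rowSum; fun_prop
  have hL2 (j : Fin n) : MemLp (X j) 2 P := by
    have := (h j).memLp
    rwa [memLp_map_measure_iff (by fun_prop) (hX j)] at this
  have hmean : ∫ x, x ∂(P.map (_root_.rowSum X)) = ∑ j, ∫ x, x ∂(P.map (X j)) := by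
    rw [integral_map hS (by fun_prop)]
    unfold _root_.rowSum
    rw [integral_finsetSum _ (fun j _ => (hL2 j).integrable (by norm_num))]
    refine Finset.sum_congr rfl fun j _ => ?_
    rw [integral_map (hX j) (by fun_prop)]
  have hvar : Var[id; P.map (_root_.rowSum X)] = ∑ j, Var[id; P.map (X j)] := by
    rw [variance_map (by fun_prop) hS]
    have e : id ∘ _root_.rowSum X = ∑ j, X j := by
      ext ω; simp [_root_.rowSum]
    rw [e, IndepFun.variance_sum (fun j _ => hL2 j)
      (fun i _ j _ hij => hindep.indepFun hij)]
    refine Finset.sum_congr rfl fun j _ => ?_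
    rw [variance_map (by fun_prop) (hX j)]
    rfl
  have hchar (t : ℝ) : charFun (P.map (_root_.rowSum X)) t = ∏ j, charFun (P.map (X j)) t := by
    have := congrFun (hindep.charFun_map_fun_sum_eq_prod hX) t
    rw [Finset.prod_apply] at this
    exact this
  refine ⟨Measure.isProbabilityMeasure_map hS, ?_, ?_, fun t ht => ?_, fun t => ?_⟩
  · have hall : ∀ᵐ ω ∂P, ∀ j, ∃ n : ℤ, X j ω = n :=
      ae_all_iff.2 fun j => ae_of_ae_map (hX j) (h j).ae_int
    refine (ae_map_iff hS measurableSet_int).2 ?_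
    filter_upwards [hall] with ω hω
    choose f hf using hω
    exact ⟨∑ j, f j, by simp [_root_.rowSum, hf]⟩
  · rw [memLp_map_measure_iff (by fun_prop) hS]
    exact memLp_finsetSum Finset.univ fun j _ => hL2 j
  · rw [hchar, hvar, norm_prod]
    refine (Finset.prod_le_prod (fun _ _ => norm_nonneg _)
      (fun j _ => (h j).norm_charFun_le t ht)).trans (le_of_eq ?_)
    rw [← Real.exp_sum, Finset.sum_neg_distrib, Finset.mul_sum, Finset.sum_mul]
  · have e1 : charFun (P.map (_root_.rowSum X)) t
          * Complex.exp (-(t * (∫ x, x ∂(P.map (_root_.rowSum X))) * Complex.I))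
        = ∏ j, (charFun (P.map (X j)) t
          * Complex.exp (-(t * (∫ x, x ∂(P.map (X j))) * Complex.I))) := by
      rw [Finset.prod_mul_distrib, ← hchar, ← Complex.exp_sum, hmean, Finset.sum_neg_distrib]
      push_cast
      rw [Finset.mul_sum, Finset.sum_mul]
    have e2 : Complex.exp (-(Var[id; P.map (_root_.rowSum X)] * t ^ 2 / 2))
        = ∏ j, Complex.exp (-(Var[id; P.map (X j)] * t ^ 2 / 2)) := by
      rw [← Complex.exp_sum, hvar, Finset.sum_neg_distrib]
      push_cast
      rw [Finset.sum_mul, Finset.sum_div]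
    have e3 : K * Var[id; P.map (_root_.rowSum X)] * |t| ^ 3
        = ∑ j, K * Var[id; P.map (X j)] * |t| ^ 3 := by
      rw [hvar, Finset.mul_sum, Finset.sum_mul]
    rw [e1, e2, e3]
    refine (norm_prod_sub_prod_le_sum _ _ _ (fun j _ => ?_) (fun j _ => ?_)).trans
      (Finset.sum_le_sum fun j _ => (h j).norm_sub_le t)
    · have := (h j).isProbabilityMeasure
      have h1 : -((t : ℂ) * ((∫ x, x ∂(P.map (X j)) : ℝ) : ℂ) * Complex.I)
          = ((-(t * ∫ x, x ∂(P.map (X j))) : ℝ) : ℂ) * Complex.I := by push_cast; ring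
      rw [norm_mul, h1, Complex.norm_exp_ofReal_mul_I, mul_one]
      exact norm_charFun_le_one _
    · have h1 : -((Var[id; P.map (X j)] : ℂ) * (t : ℂ) ^ 2 / 2)
          = ((-(Var[id; P.map (X j)] * t ^ 2 / 2) : ℝ) : ℂ) := by push_cast; ring
      rw [h1, ← Complex.ofReal_exp, Complex.norm_real, Real.norm_of_nonneg (Real.exp_pos _).le,
        Real.exp_le_one_iff, neg_nonpos]
      have := variance_nonneg id (P.map (X j))
      positivity

theorem localError_nonneg {Ω : Type*} [MeasurableSpace Ω] (P : Measure Ω) {n : ℕ}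
    (X : Fin n → Ω → ℝ) (k : ℤ) : 0 ≤ localError P X k := abs_nonneg _

theorem bddAbove_range_localError {Ω : Type*} [MeasurableSpace Ω] (P : Measure Ω)
    [IsProbabilityMeasure P] {n : ℕ} (X : Fin n → Ω → ℝ) :
    BddAbove (Set.range (localError P X)) := by
  refine ⟨rowStd P X * Real.sqrt (2 * Real.pi) * 1 + 1, ?_⟩
  rintro _ ⟨k, rfl⟩
  have hb : 0 ≤ rowStd P X := Real.sqrt_nonneg _
  refine (abs_sub _ _).trans (add_le_add ?_ ?_)
  · rw [abs_of_nonneg (by positivity)]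
    gcongr
    exact measureReal_le_one
  · rw [abs_of_pos (Real.exp_pos _), Real.exp_le_one_iff, neg_nonpos]
    positivity

theorem localError_le_of_gaussianLike {Ω : Type*} [MeasurableSpace Ω] {P : Measure Ω} {n : ℕ}
    {X : Fin n → Ω → ℝ} {c K : ℝ} (hS : AEMeasurable (rowSum X) P)
    (h : GaussianLike (P.map (rowSum X)) c K) (hc : 0 < c) (hK : 0 ≤ K) (hb : 0 < rowStd P X)
    (k : ℤ) :
    localError P X k ≤ (Real.sqrt (2 * Real.pi))⁻¹ * ∫ u, charFunErrorBound c K (rowStd P X) u := by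
  have hmean : ∫ x, x ∂(P.map (rowSum X)) = rowMean P X := integral_map hS (by fun_prop)
  have hvar : Var[id; P.map (rowSum X)] = rowStd P X ^ 2 := by
    rw [variance_map (by fun_prop) hS, rowStd,
      Real.sq_sqrt (integral_nonneg fun ω => sq_nonneg _), Function.id_comp,
      variance_eq_integral hS]
    rfl
  have hreal : P.real {ω | rowSum X ω = (k : ℝ)} = (P.map (rowSum X)).real {(k : ℝ)} := by
    rw [measureReal_def, measureReal_def, Measure.map_apply_of_aemeasurable hS
      (measurableSet_singleton _)]
    rfl
  have := h.abs_sub_le hc hK hb hvar k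
  rwa [hmean, ← hreal] at this

theorem mainTheorem8
    {Ω : ℕ → Type*} [∀ N, MeasurableSpace (Ω N)]
    (P : ∀ N, Measure (Ω N)) [∀ N, IsProbabilityMeasure (P N)]
    (J : ℕ → ℕ)
    (X : ∀ N, Fin (J N) → Ω N → ℝ)
    (J₁ J₂ : ∀ N, Finset (Fin (J N)))
    (ρ : ∀ N, Fin (J N) → unitInterval)
    (l : ∀ N, Fin (J N) → ℝ≥0)
    (hJ : ∀ N ≥ 1, 1 ≤ J N)
    (hdisj : ∀ N ≥ 1, Disjoint (J₁ N) (J₂ N))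
    (hunion : ∀ N ≥ 1, J₁ N ∪ J₂ N = Finset.univ)
    (hindep : ∀ N ≥ 1, iIndepFun (X N) (P N))
    (hρ_lt : ∀ N ≥ 1, ∀ j ∈ J₁ N, (ρ N j : ℝ) < 1)
    (hgeom : ∀ N ≥ 1, ∀ j ∈ J₁ N, HasLaw (X N j) (geometricLaw (ρ N j)) (P N))
    (hl_pos : ∀ N ≥ 1, ∀ j ∈ J₂ N, 0 < l N j)
    (hpois : ∀ N ≥ 1, ∀ j ∈ J₂ N, HasLaw (X N j) (poissonLaw (l N j)) (P N))
    (hbound : ∃ r : ℝ, r < 1 ∧ ∀ N ≥ 1, ∀ j ∈ J₁ N, (ρ N j : ℝ) ≤ r)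
    (hb : Tendsto (fun N => rowStd (P N) (X N)) atTop atTop) :
    (∀ N ≥ 1, BddAbove (Set.range (localError (P N) (X N)))) ∧
      Tendsto (fun N => ⨆ k : ℤ, localError (P N) (X N) k) atTop (𝓝 0) := by
  refine ⟨fun N _ => bddAbove_range_localError (P N) (X N), ?_⟩
  obtain ⟨r, hr1, hr⟩ := hbound
  set s : ℝ := max r 0 with hs
  have hs1 : s < 1 := max_lt hr1 one_pos
  have hs0 : 0 < 1 - s := by linarith
  have hs' : 1 - s ≤ 1 := by linarith [le_max_right r 0]
  set c : ℝ := 2 / Real.pi ^ 2 / (1 + 4 / (1 - s) ^ 2) with hc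
  set K : ℝ := 8 / (1 - s) with hK
  have hc0 : 0 < c := by positivity
  have hc1 : c ≤ 2 / Real.pi ^ 2 :=
    div_le_self (by positivity) (le_add_of_nonneg_right (by positivity))
  have hK4 : 4 ≤ K := by
    rw [hK, le_div_iff₀ hs0]; linarith
  have hlaw : ∀ N ≥ 1, ∀ j, AEMeasurable (X N j) (P N) ∧
      GaussianLike ((P N).map (X N j)) c K := by
    intro N hN j
    have hj : j ∈ J₁ N ∪ J₂ N := by rw [hunion N hN]; exact Finset.mem_univ j
    rcases Finset.mem_union.1 hj with hj | hj
    · have h := hgeom N hN j hj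
      refine ⟨h.aemeasurable, ?_⟩
      rw [h.map_eq]
      exact gaussianLike_geometricLaw _ ((hr N hN j hj).trans (le_max_left r 0)) hs1
        le_rfl le_rfl
    · have h := hpois N hN j hj
      refine ⟨h.aemeasurable, ?_⟩
      rw [h.map_eq]
      exact gaussianLike_poissonLaw _ hc1 hK4
  have hlim : Tendsto (fun N => (Real.sqrt (2 * Real.pi))⁻¹
      * ∫ u, charFunErrorBound c K (rowStd (P N) (X N)) u) atTop (𝓝 0) := by
    have h := ((tendsto_integral_charFunErrorBound hc0 (by linarith : 0 ≤ K)).comp hb).const_mul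
      (Real.sqrt (2 * Real.pi))⁻¹
    rwa [mul_zero] at h
  refine squeeze_zero' (Eventually.of_forall fun N =>
    Real.iSup_nonneg fun k => localError_nonneg (P N) (X N) k) ?_ hlim
  filter_upwards [eventually_ge_atTop 1, hb.eventually_gt_atTop 0] with N hN hbN
  have hX := fun j => (hlaw N hN j).1
  have hS : AEMeasurable (rowSum (X N)) (P N) := by
    unfold rowSum; fun_prop
  exact ciSup_le fun k => localError_le_of_gaussianLike hS
    (GaussianLike.rowSum hX (hindep N hN) (fun j => (hlaw N hN j).2)) hc0
    (by linarith) hbN k
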